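/- For ultrafilters $\mathcal U$ on $I$ and $\mathcal V$ on $J$, let $\mathcal U\otimes\mathcal V$ be the ultrafilter on $I\times J$ given by $$X\in\mathcal U\otimes\mathcal V\iff\{i\in I:\{j\in J:(i,j)\in X\}\in\mathcal V\}\in\mathcal U .$$ For a unital $C^*$-algebra $A$ with a tracial state $\tau$, an index set $I$ and an ultrafilter $\omega$ on $I$, let $A^\omega$ be the tracial ultrapower $$A^\omega=\ell^\infty(I,A)\big/\{(x_i)_{i}:\lim_{i\to\omega}\tau(x_i^*x_i)=0\},\qquad \tau_\omega\big([(x_i)_i]\big)=\lim_{i\to\omega}\tau(x_i),$$ a $C^*$-algebra with the tracial state $\tau_\omega$. Let $R$ be the hyperfinite $\mathrm{II}_1$ factor with its trace $\tau$, and let $\omega,\omega'$ be ultrafilters on $\mathbb N$. Then $$(R^{\omega})^{\omega'}\;\cong\;R^{\,\omega'\otimes\omega},$$ where the iterated ultrapower is formed with respect to the trace $\tau_\omega$ of $R^\omega$ and the ultrapower on the right is taken over $\mathbb N\times\mathbb N$: there is a $*$-isomorphism $(R^\omega)^{\omega'}\to R^{\omega'\otimes\omega}$ that carries the trace $(\tau_\omega)_{\omega'}$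 to the trace $\tau_{\omega'\otimes\omega}$. (Interchanging the names of the two ultrafilters, equivalently $(R^{\omega'})^{\omega}\cong R^{\omega\otimes\omega'}$.) -/

import Mathlib

open Filter Topology
open scoped ComplexOrder BoundedContinuousFunction

noncomputable section

/-! ### Tensor product of ultrafilters -/

/-- The tensor product `U ⊗ V` of two ultrafilters: a set `X ⊆ I × J` belongs to it if and only if
`{i | {j | (i, j) ∈ X} ∈ V} ∈ U`. -/
def ultrafilterTensor {I J : Type*} (U : Ultrafilter I) (V : Ultrafilter J) :
    Ultrafilter (I × J) :=
  Ultrafilter.ofComplNotMemIff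
    { sets := {X | {i | {j | (i, j) ∈ X} ∈ V} ∈ U}
      univ_sets := by
        have h : {i : I | {j : J | (i, j) ∈ (Set.univ : Set (I × J))} ∈ V} = Set.univ :=
          Set.eq_univ_of_forall fun _ => univ_mem (f := (V : Filter J))
        change {i : I | {j : J | (i, j) ∈ (Set.univ : Set (I × J))} ∈ V} ∈ U
        rw [h]
        exact univ_mem (f := (U : Filter I))
      sets_of_superset := by
        intro X Y hX hXY
        refine mem_of_superset (f := (U : Filter I)) hX fun i hi => ?_
        exact mem_of_superset (f := (V : Filter J)) hi fun j hj => hXY hj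
      inter_sets := by
        intro X Y hX hY
        refine mem_of_superset (f := (U : Filter I)) (inter_mem hX hY) fun i hi => ?_
        exact inter_mem (f := (V : Filter J)) hi.1 hi.2 }
    (by
      intro X
      change {i | {j | (i, j) ∈ Xᶜ} ∈ V} ∉ U ↔ {i | {j | (i, j) ∈ X} ∈ V} ∈ U
      rw [← Ultrafilter.compl_mem_iff_notMem]
      have : {i | {j | (i, j) ∈ Xᶜ} ∈ V}ᶜ = {i | {j | (i, j) ∈ X} ∈ V} := by
        ext i
        exact Ultrafilter.compl_notMem_iff (f := V) (s := {j | (i, j) ∈ X})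
      rw [this])

theorem mem_ultrafilterTensor {I J : Type*} (U : Ultrafilter I) (V : Ultrafilter J)
    (X : Set (I × J)) :
    X ∈ ultrafilterTensor U V ↔ {i | {j | (i, j) ∈ X} ∈ V} ∈ U :=
  Iff.rfl

/-! ### Tracial states and the quotient by their null ideal -/

/-- A tracial state on a unital C⋆-algebra: a linear functional `τ` with `τ 1 = 1`,
`τ (a⋆ a) ≥ 0` and `τ (a b) = τ (b a)`. (On a II₁ factor there is exactly one, the trace.) -/
structure TracialState (A : Type*) [CStarAlgebra A] extends A →ₗ[ℂ] ℂ where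
  map_one' : toFun 1 = 1
  star_mul_self_nonneg' : ∀ a, 0 ≤ toFun (star a * a)
  mul_comm' : ∀ a b, toFun (a * b) = toFun (b * a)

namespace TracialState

section Basic

variable {A : Type*} [CStarAlgebra A]

instance : CoeFun (TracialState A) fun _ => A → ℂ := ⟨fun τ => τ.toLinearMap⟩

theorem map_one (τ : TracialState A) : τ 1 = 1 := τ.map_one'

theorem star_mul_self_nonneg (τ : TracialState A) (a : A) : 0 ≤ τ (star a * a) :=
  τ.star_mul_self_nonneg' a

theorem mul_comm (τ : TracialState A) (a b : A) : τ (a * b) = τ (b * a) := τ.mul_comm' a b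

theorem map_nonneg [PartialOrder A] [StarOrderedRing A] (τ : TracialState A) {a : A}
    (ha : 0 ≤ a) : 0 ≤ τ a := by
  obtain ⟨b, rfl⟩ := CStarAlgebra.nonneg_iff_eq_star_mul_self.mp ha
  exact τ.star_mul_self_nonneg b

theorem exists_bound (τ : TracialState A) : ∃ C : ℝ, 0 ≤ C ∧ ∀ a, ‖τ a‖ ≤ C * ‖a‖ := by
  let _ := CStarAlgebra.spectralOrder A
  have := CStarAlgebra.spectralOrderedRing A
  obtain ⟨C, hC⟩ := (PositiveLinearMap.mk₀ τ.toLinearMap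
    fun x hx => τ.map_nonneg hx).exists_norm_apply_le
  exact ⟨C, C.2, hC⟩

theorem continuous (τ : TracialState A) : Continuous τ := by
  obtain ⟨C, -, hC⟩ := τ.exists_bound
  exact (τ.toLinearMap.mkContinuous C hC).continuous

theorem mul_le (τ : TracialState A) (b x : A) :
    τ (star (b * x) * (b * x)) ≤ (‖b‖ ^ 2 : ℝ) * τ (star x * x) := by
  let _ := CStarAlgebra.spectralOrder A
  have := CStarAlgebra.spectralOrderedRing A
  have h : 0 ≤ star x * (algebraMap ℝ A (‖b‖ ^ 2) - star b * b) * x :=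
    star_left_conjugate_nonneg (sub_nonneg.mpr CStarAlgebra.star_mul_le_algebraMap_norm_sq) x
  have h' := τ.map_nonneg h
  have e : star x * (algebraMap ℝ A (‖b‖ ^ 2) - star b * b) * x
      = ((‖b‖ ^ 2 : ℝ) : ℂ) • (star x * x) - star (b * x) * (b * x) := by
    rw [Algebra.algebraMap_eq_smul_one, Complex.coe_smul, star_mul]
    simp only [mul_sub, sub_mul, mul_smul_comm, smul_mul_assoc, mul_one, mul_assoc]
  rw [e, map_sub, map_smul, sub_nonneg, smul_eq_mul] at h'
  exact h'

/-- The closed two-sided ideal `{x | τ (x⋆ x) = 0}` of elements of trace-norm `‖x‖₂ = 0`. -/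
def nullIdeal (τ : TracialState A) : Ideal A where
  carrier := {x | τ (star x * x) = 0}
  zero_mem' := by simp
  add_mem' := by
    intro x y hx hy
    have hx' : τ (star x * x) = 0 := hx
    have hy' : τ (star y * y) = 0 := hy
    have e : star (x + y) * (x + y) + star (x - y) * (x - y)
        = (star x * x + star x * x) + (star y * y + star y * y) := by
      simp only [star_add, star_sub]
      noncomm_ring
    have h := congrArg τ e
    simp only [map_add, hx', hy', add_zero] at h
    exact ((add_eq_zero_iff_of_nonneg (τ.star_mul_self_nonneg _)
      (τ.star_mul_self_nonneg _)).mp h).1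
  smul_mem' := by
    intro b x hx
    have hx' : τ (star x * x) = 0 := hx
    have h := τ.mul_le b x
    rw [hx', mul_zero] at h
    exact le_antisymm h (τ.star_mul_self_nonneg _)

theorem mem_nullIdeal {τ : TracialState A} {x : A} :
    x ∈ τ.nullIdeal ↔ τ (star x * x) = 0 := Iff.rfl

theorem star_mem_nullIdeal {τ : TracialState A} {x : A} (hx : x ∈ τ.nullIdeal) :
    star x ∈ τ.nullIdeal := by
  rw [mem_nullIdeal] at hx ⊢
  rw [star_star, τ.mul_comm, hx]

instance (τ : TracialState A) : τ.nullIdeal.IsTwoSided where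
  mul_mem_of_left := by
    intro a b ha
    have h := star_mem_nullIdeal (τ.nullIdeal.mul_mem_left (star b) (star_mem_nullIdeal ha))
    simpa using h

instance isClosed_nullIdeal (τ : TracialState A) : IsClosed (τ.nullIdeal : Set A) := by
  have h : Continuous fun x : A => τ (star x * x) :=
    τ.continuous.comp (continuous_star.mul continuous_id)
  exact isClosed_singleton.preimage (f := fun x : A => τ (star x * x)) (t := {0}) h

theorem map_eq_zero_of_mem {τ : TracialState A} {x : A} (hx : x ∈ τ.nullIdeal) : τ x = 0 := by
  have key : ∀ c : ℂ, 0 ≤ star c * τ x + c * τ (star x) + star c * c := by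
    intro c
    have h := τ.star_mul_self_nonneg (x + c • 1)
    have e : star (x + c • (1 : A)) * (x + c • 1)
        = star x * x + star c • x + c • star x + (star c * c) • 1 := by
      simp only [star_add, star_smul, star_one, add_mul, mul_add, smul_mul_assoc, mul_smul_comm,
        mul_one, one_mul, smul_add, smul_smul, _root_.mul_comm c (star c)]
      abel
    rw [e] at h
    simp only [map_add, map_smul, mem_nullIdeal.mp hx, τ.map_one, smul_eq_mul, mul_one,
      zero_add] at h
    exact h
  set z := τ x
  set w := τ (star x)
  have k (a b : ℝ) := (Complex.le_def.mp (key (a + b * Complex.I)))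
  simp only [Complex.star_def, Complex.zero_re, Complex.add_re, Complex.mul_re, Complex.conj_re,
    Complex.conj_im, Complex.ofReal_re, Complex.ofReal_im, Complex.I_re, Complex.I_im,
    Complex.add_im, Complex.mul_im, Complex.zero_im] at k
  have hi1 := (k 1 0).2
  have hi2 := (k 0 1).2
  have l1 : z.re + w.re = 0 := by
    have h1 := (k (-(z.re + w.re) / 2) 0).1
    nlinarith [sq_nonneg (z.re + w.re)]
  have l2 : z.im - w.im = 0 := by
    have h1 := (k 0 (-(z.im - w.im) / 2)).1
    nlinarith [sq_nonneg (z.im - w.im)]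
  apply Complex.ext
  · simp only [Complex.zero_re]; linarith
  · simp only [Complex.zero_im]; linarith

/-- The quotient of a C⋆-algebra by the null ideal of a tracial state, with the quotient
algebraic operations and the quotient norm. -/
def NullQuotient (τ : TracialState A) : Type _ := A ⧸ τ.nullIdeal

namespace NullQuotient

variable (τ : TracialState A)

instance : Ring τ.NullQuotient := inferInstanceAs (Ring (A ⧸ τ.nullIdeal))

instance : Algebra ℂ τ.NullQuotient := inferInstanceAs (Algebra ℂ (A ⧸ τ.nullIdeal))

/-- The quotient map. -/
def mk : A →ₐ[ℂ] τ.NullQuotient := Ideal.Quotient.mkₐ ℂ τ.nullIdeal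

theorem mk_surjective : Function.Surjective (mk τ) := Ideal.Quotient.mk_surjective

theorem mk_eq_zero {x : A} : mk τ x = 0 ↔ x ∈ τ.nullIdeal := Ideal.Quotient.eq_zero_iff_mem

theorem mk_eq {x y : A} : mk τ x = mk τ y ↔ x - y ∈ τ.nullIdeal := Ideal.Quotient.eq

instance : NormedAddCommGroup τ.NullQuotient :=
  inferInstanceAs (NormedAddCommGroup (A ⧸ τ.nullIdeal))

theorem exists_norm_lt (q : τ.NullQuotient) {ε : ℝ} (hε : 0 < ε) :
    ∃ x : A, mk τ x = q ∧ ‖x‖ < ‖q‖ + ε :=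
  Submodule.Quotient.norm_mk_lt (S := τ.nullIdeal) q hε

theorem norm_mk_le (x : A) : ‖mk τ x‖ ≤ ‖x‖ := Submodule.Quotient.norm_mk_le τ.nullIdeal x

instance : CompleteSpace τ.NullQuotient := inferInstanceAs (CompleteSpace (A ⧸ τ.nullIdeal))

instance : NormedRing τ.NullQuotient where
  __ := (inferInstance : Ring τ.NullQuotient)
  __ := (inferInstance : NormedAddCommGroup τ.NullQuotient)
  norm_mul_le p q := by
    have h : ∀ ε : ℝ, 0 < ε → ‖p * q‖ ≤ (‖p‖ + ε) * (‖q‖ + ε) := by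
      intro ε hε
      obtain ⟨x, rfl, hx⟩ := exists_norm_lt τ p hε
      obtain ⟨y, rfl, hy⟩ := exists_norm_lt τ q hε
      rw [← map_mul]
      exact (norm_mk_le τ _).trans ((norm_mul_le x y).trans
        (mul_le_mul hx.le hy.le (norm_nonneg _) (by positivity)))
    have ht : Tendsto (fun ε : ℝ => (‖p‖ + ε) * (‖q‖ + ε)) (𝓝[>] 0)
        (𝓝 ((‖p‖ + 0) * (‖q‖ + 0))) :=
      Tendsto.mono_left (Continuous.tendsto (by fun_prop) 0) nhdsWithin_le_nhds
    rw [add_zero, add_zero] at ht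
    exact ge_of_tendsto ht (eventually_nhdsWithin_of_forall fun ε hε => h ε hε)

instance : NormedAlgebra ℂ τ.NullQuotient where
  __ := (inferInstance : Algebra ℂ τ.NullQuotient)
  norm_smul_le c q :=
    (inferInstance : NormedSpace ℂ (A ⧸ τ.nullIdeal)).norm_smul_le c q

instance : Star τ.NullQuotient where
  star := Quotient.map' star (by
    intro x y h
    have h' := (Submodule.quotientRel_def τ.nullIdeal).mp h
    refine (Submodule.quotientRel_def τ.nullIdeal).mpr ?_
    simpa using star_mem_nullIdeal h')

theorem star_mk (x : A) : star (mk τ x) = mk τ (star x) := rfl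

instance : StarRing τ.NullQuotient where
  star_involutive q := by
    obtain ⟨x, rfl⟩ := mk_surjective τ q
    rw [star_mk, star_mk, star_star]
  star_mul p q := by
    obtain ⟨x, rfl⟩ := mk_surjective τ p
    obtain ⟨y, rfl⟩ := mk_surjective τ q
    rw [← map_mul, star_mk, star_mul, map_mul, star_mk, star_mk]
  star_add p q := by
    obtain ⟨x, rfl⟩ := mk_surjective τ p
    obtain ⟨y, rfl⟩ := mk_surjective τ q
    rw [← map_add, star_mk, star_add, map_add, star_mk, star_mk]

instance : StarModule ℂ τ.NullQuotient where
  star_smul c q := by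
    obtain ⟨x, rfl⟩ := mk_surjective τ q
    rw [← map_smul, star_mk, star_smul, map_smul, star_mk]

/-- The null ideal as a nonunital star subalgebra, used for its approximate unit. -/
def nullStarSubalgebra : NonUnitalStarSubalgebra ℂ A where
  carrier := τ.nullIdeal
  add_mem' := τ.nullIdeal.add_mem
  zero_mem' := τ.nullIdeal.zero_mem
  mul_mem' := fun {a b} _ hb => τ.nullIdeal.mul_mem_left a hb
  smul_mem' := fun c x hx => by
    have := τ.nullIdeal.mul_mem_left (c • 1) hx
    simpa using this
  star_mem' := star_mem_nullIdeal

instance : IsClosed (nullStarSubalgebra τ : Set A) := isClosed_nullIdeal τ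

/-- The null ideal has right approximate units `e` with `‖1 - e‖ ≤ 1`. -/
theorem exists_approx {y : A} (hy : y ∈ τ.nullIdeal) {ε : ℝ} (hε : 0 < ε) :
    ∃ e ∈ τ.nullIdeal, ‖1 - e‖ ≤ 1 ∧ ‖y * (1 - e)‖ ≤ ε := by
  let J := nullStarSubalgebra τ
  let _ := CStarAlgebra.spectralOrder A
  have := CStarAlgebra.spectralOrderedRing A
  let : PartialOrder J := CStarAlgebra.spectralOrder J
  have : StarOrderedRing J := CStarAlgebra.spectralOrderedRing J
  have hl := CStarAlgebra.increasingApproximateUnit J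
  have h1 := hl.tendsto_mul_left ⟨y, hy⟩
  have h2 := (Metric.tendsto_nhds.mp h1) ε hε
  obtain ⟨e, ⟨he0, he1⟩, he2⟩ := ((hl.eventually_nonneg.and hl.eventually_norm).and h2).exists
  have hpos : (0 : A) ≤ (e : A) := by
    obtain ⟨c, hc⟩ := CStarAlgebra.nonneg_iff_eq_star_mul_self.mp he0
    rw [hc]
    exact _root_.star_mul_self_nonneg (c : A)
  refine ⟨e, e.2, ?_, ?_⟩
  · have hm : (e : A) ∈ Set.Icc 0 1 := CStarAlgebra.mem_Icc_iff_norm_le_one.mpr ⟨hpos, he1⟩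
    exact (CStarAlgebra.mem_Icc_iff_norm_le_one.mp
      (Set.sub_mem_Icc_zero_iff_right.mpr hm)).2
  · rw [dist_comm, dist_eq_norm] at he2
    rw [mul_sub, mul_one]
    exact he2.le

instance : CStarRing τ.NullQuotient where
  norm_mul_self_le q := by
    obtain ⟨b, rfl⟩ := mk_surjective τ q
    refine le_of_forall_pos_le_add fun ε hε => ?_
    obtain ⟨m, hm, hmn⟩ := exists_norm_lt τ (star (mk τ b) * mk τ b) (half_pos hε)
    have hy : m - star b * b ∈ τ.nullIdeal := by
      rw [← mk_eq, hm, map_mul, star_mk]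
    obtain ⟨e, he, he1, he2⟩ := exists_approx τ hy (half_pos hε)
    have hq : ‖mk τ b‖ ≤ ‖b * (1 - e)‖ := by
      have : mk τ b = mk τ (b * (1 - e)) := by
        rw [mk_eq, mul_sub, mul_one, sub_sub_cancel]
        exact τ.nullIdeal.mul_mem_left b he
      rw [this]
      exact norm_mk_le τ _
    have hs : ‖star (1 - e)‖ ≤ 1 := by rw [norm_star]; exact he1
    have e1 : star (b * (1 - e)) * (b * (1 - e))
        = star (1 - e) * (m * (1 - e)) - star (1 - e) * ((m - star b * b) * (1 - e)) := by
      rw [star_mul]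
      noncomm_ring
    calc ‖mk τ b‖ * ‖mk τ b‖ ≤ ‖b * (1 - e)‖ * ‖b * (1 - e)‖ := by gcongr
      _ = ‖star (b * (1 - e)) * (b * (1 - e))‖ := CStarRing.norm_star_mul_self.symm
      _ ≤ ‖star (1 - e) * (m * (1 - e))‖ + ‖star (1 - e) * ((m - star b * b) * (1 - e))‖ := by
        rw [e1]; exact norm_sub_le _ _
      _ ≤ 1 * (‖m‖ * 1) + 1 * (ε / 2) := by
        refine add_le_add ?_ ?_
        · refine (norm_mul_le _ _).trans (mul_le_mul hs ?_ (norm_nonneg _) zero_le_one)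
          exact (norm_mul_le _ _).trans (mul_le_mul_of_nonneg_left he1 (norm_nonneg _))
        · exact (norm_mul_le _ _).trans (mul_le_mul hs he2 (norm_nonneg _) zero_le_one)
      _ ≤ ‖star (mk τ b) * mk τ b‖ + ε := by linarith

instance : CStarAlgebra τ.NullQuotient where

end NullQuotient

/-- The tracial state induced by `τ` on the quotient by its null ideal: `[x] ↦ τ x`. -/
def quotientTrace (τ : TracialState A) : TracialState τ.NullQuotient where
  toFun := Quotient.lift τ (by
    intro x y h
    have h' := (Submodule.quotientRel_def τ.nullIdeal).mp h
    have h0 := map_eq_zero_of_mem h'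
    rwa [map_sub, sub_eq_zero] at h0)
  map_add' p q := by
    obtain ⟨x, rfl⟩ := NullQuotient.mk_surjective τ p
    obtain ⟨y, rfl⟩ := NullQuotient.mk_surjective τ q
    exact map_add τ.toLinearMap x y
  map_smul' c q := by
    obtain ⟨x, rfl⟩ := NullQuotient.mk_surjective τ q
    exact map_smul τ.toLinearMap c x
  map_one' := τ.map_one
  star_mul_self_nonneg' q := by
    obtain ⟨x, rfl⟩ := NullQuotient.mk_surjective τ q
    exact τ.star_mul_self_nonneg x
  mul_comm' p q := by
    obtain ⟨x, rfl⟩ := NullQuotient.mk_surjective τ p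
    obtain ⟨y, rfl⟩ := NullQuotient.mk_surjective τ q
    exact τ.mul_comm x y

theorem quotientTrace_mk (τ : TracialState A) (x : A) :
    τ.quotientTrace (NullQuotient.mk τ x) = τ x := rfl

end Basic

/-! ### Tracial ultrapowers -/

section Ultrapower

variable {A : Type*} [CStarAlgebra A] {ι : Type*} [TopologicalSpace ι] [DiscreteTopology ι]

theorem tendsto_limUnder (τ : TracialState A) (ω : Ultrafilter ι) (x : ι →ᵇ A) :
    Tendsto (fun i => τ (x i)) ω (𝓝 (limUnder (ω : Filter ι) fun i => τ (x i))) := by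
  obtain ⟨C, hC0, hC⟩ := τ.exists_bound
  have hb : ∀ i, τ (x i) ∈ Metric.closedBall (0 : ℂ) (C * ‖x‖) := by
    intro i
    rw [mem_closedBall_zero_iff]
    exact (hC _).trans (mul_le_mul_of_nonneg_left (x.norm_coe_le_norm i) hC0)
  obtain ⟨l, -, hl⟩ := (isCompact_closedBall (0 : ℂ) (C * ‖x‖)).ultrafilter_le_nhds
    (ω.map fun i => τ (x i)) (by
      rw [le_principal_iff]
      exact Filter.univ_mem' (f := (ω : Filter ι)) hb)
  exact tendsto_nhds_limUnder ⟨l, hl⟩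

/-- The tracial state `(xᵢ)ᵢ ↦ lim_{i → ω} τ(xᵢ)` on the C⋆-algebra `ℓ^∞(ι, A) = (ι →ᵇ A)` of all
bounded families in `A` (the index set carries the discrete topology, so that every bounded
family is continuous) with the supremum norm. -/
def limitTrace (τ : TracialState A) (ω : Ultrafilter ι) : TracialState (ι →ᵇ A) where
  toFun x := limUnder (ω : Filter ι) fun i => τ (x i)
  map_add' x y := by
    refine Tendsto.limUnder_eq ?_
    simpa using (τ.tendsto_limUnder ω x).add (τ.tendsto_limUnder ω y)
  map_smul' c x := by
    refine Tendsto.limUnder_eq ?_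
    simpa using (τ.tendsto_limUnder ω x).const_mul c
  map_one' := by
    refine Tendsto.limUnder_eq ?_
    simp only [BoundedContinuousFunction.coe_one, Pi.one_apply, τ.map_one]
    exact tendsto_const_nhds
  star_mul_self_nonneg' x :=
    ge_of_tendsto' (τ.tendsto_limUnder ω (star x * x)) fun i => τ.star_mul_self_nonneg (x i)
  mul_comm' x y := by
    refine Tendsto.limUnder_eq ?_
    have h := τ.tendsto_limUnder ω (y * x)
    refine h.congr fun i => ?_
    exact τ.mul_comm (y i) (x i)

/-- The tracial ultrapower `A^ω` of `(A, τ)`: the quotient of `ℓ^∞(ι, A)` by the ideal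
`{x | lim_{i → ω} τ(xᵢ⋆ xᵢ) = 0}`. It is a C⋆-algebra (with the quotient norm). -/
abbrev Ultrapower (τ : TracialState A) (ω : Ultrafilter ι) : Type _ :=
  (τ.limitTrace ω).NullQuotient

/-- The trace `[(xᵢ)ᵢ] ↦ lim_{i → ω} τ(xᵢ)` of the tracial ultrapower `A^ω`. -/
abbrev ultrapowerTrace (τ : TracialState A) (ω : Ultrafilter ι) :
    TracialState (τ.Ultrapower ω) :=
  (τ.limitTrace ω).quotientTrace

end Ultrapower

end TracialState

/-! ### The hyperfinite II₁ factor -/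

section Factor

variable {H : Type*} [NormedAddCommGroup H] [InnerProductSpace ℂ H] [CompleteSpace H]

instance isClosed_vonNeumannAlgebra (M : VonNeumannAlgebra H) :
    IsClosed (M.toStarSubalgebra : Set (H →L[ℂ] H)) := by
  have h : (M.toStarSubalgebra : Set (H →L[ℂ] H))
      = Set.centralizer (Set.centralizer (M : Set (H →L[ℂ] H))) :=
    M.centralizer_centralizer.symm
  rw [h]
  exact Set.isClosed_centralizer _

/-- A von Neumann algebra is a II₁ factor if it has trivial center, is finite (every isometry in
it is unitary), and is infinite-dimensional. -/
structure IsII1Factor (M : VonNeumannAlgebra H) : Prop where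
  factor : ∀ z ∈ M, z ∈ M.commutant → ∃ c : ℂ, z = c • (1 : H →L[ℂ] H)
  finite : ∀ v ∈ M, star v * v = 1 → v * star v = 1
  infinite_dimensional : ¬ FiniteDimensional ℂ M.toStarSubalgebra

/-- A von Neumann algebra is hyperfinite if it is the bicommutant (equivalently the weak closure)
of the union of an increasing sequence of finite-dimensional unital star subalgebras. -/
def IsHyperfinite (M : VonNeumannAlgebra H) : Prop :=
  ∃ B : ℕ → StarSubalgebra ℂ (H →L[ℂ] H), Monotone B ∧ (∀ n, FiniteDimensional ℂ (B n)) ∧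
    Set.centralizer (Set.centralizer (⋃ n, (B n : Set (H →L[ℂ] H)))) = M

end Factor

end

open scoped BoundedContinuousFunction

noncomputable section

namespace TracialState

/-! ### Trace-preserving homomorphisms and null ideals -/

section Quotients

variable {A B : Type*} [CStarAlgebra A] [CStarAlgebra B]

/-! For an algebra `A` with tracial state `τ`, both ultrapowers are quotients of the algebra `κ × ι
→ᵇ A` of bounded double families, by the same ideal. Cutting a double family into its sections `j ↦
x (i, j)` gives a star homomorphism `sectionHom` onto `κ →ᵇ τ.Ultrapower ω`. It is onto because the
norm of the ultrapower is a quotient norm, so representatives can be chosen uniformly bounded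
(`sectionHom_surjective`). It preserves the limit traces because a limit along `ω' ⊗ ω` is the
iterated limit, over `ω` inside and `ω'` outside (`limitTrace_sectionHom`). A null ideal is
determined by its trace, so a surjective trace-preserving star homomorphism induces an isomorphism
of the null quotients (`NullQuotient.map_bijective`). -/

/-- A trace preserving star homomorphism descends to the quotients by the null ideals. -/
def NullQuotient.map (τ : TracialState A) (σ : TracialState B) (f : A →⋆ₐ[ℂ] B)
    (hf : ∀ a, σ (f a) = τ a) : τ.NullQuotient →⋆ₐ[ℂ] σ.NullQuotient where
  __ := (Ideal.Quotient.liftₐ τ.nullIdeal ((NullQuotient.mk σ).comp f.toAlgHom) (by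
    intro a ha
    refine (NullQuotient.mk_eq_zero σ).mpr ?_
    change σ (star (f a) * f a) = 0
    rw [← map_star, ← map_mul, hf]
    exact ha) : A ⧸ τ.nullIdeal →ₐ[ℂ] σ.NullQuotient)
  map_star' q := by
    obtain ⟨a, rfl⟩ := NullQuotient.mk_surjective τ q
    change NullQuotient.mk σ (f (star a)) = star (NullQuotient.mk σ (f a))
    rw [NullQuotient.star_mk, map_star]

theorem NullQuotient.map_mk (τ : TracialState A) (σ : TracialState B) (f : A →⋆ₐ[ℂ] B)
    (hf : ∀ a, σ (f a) = τ a) (a : A) :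
    NullQuotient.map τ σ f hf (NullQuotient.mk τ a) = NullQuotient.mk σ (f a) := rfl

/-- Since `σ (star (f a) * f a) = τ (star a * a)`, the preimage of the null ideal of `σ` is exactly
that of `τ`. Injectivity on the quotients therefore does not require `f` to be injective. -/
theorem NullQuotient.map_bijective (τ : TracialState A) (σ : TracialState B) (f : A →⋆ₐ[ℂ] B)
    (hf : ∀ a, σ (f a) = τ a) (hs : Function.Surjective f) :
    Function.Bijective (NullQuotient.map τ σ f hf) := by
  constructor
  · rw [injective_iff_map_eq_zero]
    intro q hq
    obtain ⟨a, rfl⟩ := NullQuotient.mk_surjective τ q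
    rw [NullQuotient.map_mk, NullQuotient.mk_eq_zero, mem_nullIdeal, ← map_star, ← map_mul,
      hf] at hq
    exact (NullQuotient.mk_eq_zero τ).mpr hq
  · intro q
    obtain ⟨b, rfl⟩ := NullQuotient.mk_surjective σ q
    obtain ⟨a, rfl⟩ := hs b
    exact ⟨NullQuotient.mk τ a, rfl⟩

end Quotients

/-! ### Double families and iterated ultralimits -/

section Iterated

variable {A : Type*} [CStarAlgebra A] {ι κ : Type*} [TopologicalSpace ι] [DiscreteTopology ι]
  [TopologicalSpace κ] [DiscreteTopology κ]

theorem limitTrace_eq_of_tendsto (τ : TracialState A) (ω : Ultrafilter ι) (x : ι →ᵇ A) {l : ℂ}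
    (h : Tendsto (fun i => τ (x i)) ω (𝓝 l)) : τ.limitTrace ω x = l :=
  h.limUnder_eq

/-- The section `j ↦ x (i, j)` of a bounded family indexed by a product. -/
def boundedSection (x : κ × ι →ᵇ A) (i : κ) : ι →ᵇ A :=
  x.compContinuous ⟨Prod.mk i, by fun_prop⟩

/-- A bounded double family in `A`, viewed as a bounded family in the ultrapower `A^ω`. -/
def sectionHom (τ : TracialState A) (ω : Ultrafilter ι) :
    (κ × ι →ᵇ A) →⋆ₐ[ℂ] (κ →ᵇ τ.Ultrapower ω) where
  toFun x := BoundedContinuousFunction.ofNormedAddCommGroup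
    (fun i => NullQuotient.mk (τ.limitTrace ω) (boundedSection x i)) continuous_of_discreteTopology
    ‖x‖ fun i => (NullQuotient.norm_mk_le _ _).trans
      ((BoundedContinuousFunction.norm_le (norm_nonneg x)).mpr fun j => x.norm_coe_le_norm (i, j))
  -- Operations on families are pointwise and those of the quotient are computed on representatives,
  -- so the axioms hold definitionally.
  map_one' := rfl
  map_mul' _ _ := rfl
  map_zero' := rfl
  map_add' _ _ := rfl
  commutes' _ := rfl
  map_star' _ := rfl

theorem sectionHom_apply (τ : TracialState A) (ω : Ultrafilter ι) (x : κ × ι →ᵇ A) (i : κ) :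
    sectionHom τ ω x i = NullQuotient.mk (τ.limitTrace ω) (boundedSection x i) := rfl

/-- Arbitrary representatives of a bounded family of classes need not be uniformly bounded. The
quotient norm provides representatives that are. -/
theorem sectionHom_surjective (τ : TracialState A) (ω : Ultrafilter ι) :
    Function.Surjective (sectionHom (κ := κ) τ ω) := by
  intro y
  -- Any fixed positive slack would do; the value 1 yields the uniform bound `‖y‖ + 1`.
  choose x hx hn using fun i =>
    NullQuotient.exists_norm_lt (τ.limitTrace ω) (y i) zero_lt_one
  refine ⟨BoundedContinuousFunction.ofNormedAddCommGroup (fun p : κ × ι => x p.1 p.2)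
    continuous_of_discreteTopology (‖y‖ + 1) fun p => ?_, ?_⟩
  · exact ((x p.1).norm_coe_le_norm p.2).trans
      ((hn p.1).le.trans (by gcongr; exact y.norm_coe_le_norm p.1))
  · ext i
    rw [sectionHom_apply, ← hx i]
    rfl

/-- A Fubini principle for ultralimits: a set large for `ω' ⊗ ω` has `ω`-large sections over
`ω'`-many indices. Boundedness guarantees that the inner limits exist. -/
theorem limitTrace_sectionHom (τ : TracialState A) (ω : Ultrafilter ι) (ω' : Ultrafilter κ)
    (x : κ × ι →ᵇ A) :
    (τ.ultrapowerTrace ω).limitTrace ω' (sectionHom τ ω x)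
      = τ.limitTrace (ultrafilterTensor ω' ω) x := by
  refine limitTrace_eq_of_tendsto _ _ _ ?_
  set l := τ.limitTrace (ultrafilterTensor ω' ω) x
  refine Metric.tendsto_nhds.mpr fun ε hε => ?_
  -- Half of `ε`, because a strict bound survives the inner limit only as a weak one.
  have h := Metric.tendsto_nhds.mp (τ.tendsto_limUnder (ultrafilterTensor ω' ω) x) (ε / 2)
    (half_pos hε)
  have h' : ∀ᶠ i in (ω' : Filter κ), ∀ᶠ j in (ω : Filter ι), dist (τ (x (i, j))) l < ε / 2 :=
    (mem_ultrafilterTensor ω' ω _).mp h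
  filter_upwards [h'] with i hi
  -- This inner limit is, by definition, the trace of the class `sectionHom τ ω x i`.
  have hle : dist (τ.limitTrace ω (boundedSection x i)) l ≤ ε / 2 :=
    le_of_tendsto ((τ.tendsto_limUnder ω (boundedSection x i)).dist tendsto_const_nhds)
      (hi.mono fun j hj => hj.le)
  exact hle.trans_lt (half_lt_self hε)

/-- The canonical isomorphism from `A^(ω' ⊗ ω)` to the iterated tracial ultrapower. -/
def ultrapowerTensorEquiv (τ : TracialState A) (ω : Ultrafilter ι) (ω' : Ultrafilter κ) :
    τ.Ultrapower (ultrafilterTensor ω' ω) ≃⋆ₐ[ℂ] (τ.ultrapowerTrace ω).Ultrapower ω' :=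
  StarAlgEquiv.ofBijective
    (NullQuotient.map _ _ (sectionHom τ ω) (limitTrace_sectionHom τ ω ω'))
    (NullQuotient.map_bijective _ _ _ _ (sectionHom_surjective τ ω))

theorem ultrapowerTrace_ultrapowerTensorEquiv (τ : TracialState A) (ω : Ultrafilter ι)
    (ω' : Ultrafilter κ) (q : τ.Ultrapower (ultrafilterTensor ω' ω)) :
    (τ.ultrapowerTrace ω).ultrapowerTrace ω' (ultrapowerTensorEquiv τ ω ω' q)
      = τ.ultrapowerTrace (ultrafilterTensor ω' ω) q := by
  obtain ⟨x, rfl⟩ := NullQuotient.mk_surjective _ q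
  -- On the class of `x` both traces unfold to limit traces of representatives.
  exact limitTrace_sectionHom τ ω ω' x

end Iterated

end TracialState

end

/-- Let `R` be the hyperfinite II₁ factor with its trace `τ`. Then `(R^ω)^ω'` and `R^(ω' ⊗ ω)` are
isomorphic as star algebras, by an isomorphism that carries the trace to the trace. -/
theorem mainTheorem1 {H : Type*} [NormedAddCommGroup H] [InnerProductSpace ℂ H] [CompleteSpace H]
    (R : VonNeumannAlgebra H) (hfactor : IsII1Factor R) (hhyper : IsHyperfinite R)
    (τ : TracialState R.toStarSubalgebra) (ω ω' : Ultrafilter ℕ) :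
    ∃ φ : (τ.ultrapowerTrace ω).Ultrapower ω' ≃⋆ₐ[ℂ] τ.Ultrapower (ultrafilterTensor ω' ω),
      ∀ x, τ.ultrapowerTrace (ultrafilterTensor ω' ω) (φ x) =
        (τ.ultrapowerTrace ω).ultrapowerTrace ω' x := by

  -- Sections lead from double families to the iterated ultrapower, so the required map is the
  -- inverse.
  refine ⟨(τ.ultrapowerTensorEquiv ω ω').symm, fun x => ?_⟩
  rw [← τ.ultrapowerTrace_ultrapowerTensorEquiv ω ω', StarAlgEquiv.apply_symm_apply]
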